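/- **Setting.** Let $X_1,\dots,X_F$ be quantum systems of dimensions $d_1,\dots,d_F\ge 1$, and let $M=\sum_{\ell=1}^F\log_2 d_\ell$ be the total size of the messages in qubits. In a *one-server QPIR protocol with prior entanglement, in the blind setting*, an honest server holds the systems $X_1\otimes\cdots\otimes X_F$ in a state $\rho_1\otimes\cdots\otimes\rho_F$ unknown to it (its operations do not depend on the $\rho_\ell$), and a user holds a target index $k\in\{1,\dots,F\}$, stored as $|k\rangle$. They share a maximally entangled state $e^{-1/2}\sum_{j<e}|j\rangle|j\rangle$, which counts as $\log_2 e$ ebits, and each has a local register in a fixed pure state. The server's initial memory (messages, its half of the entanglement, local register) is $S^{(0)}$; the user's initial system is $A^{(0)}\otimes T^{(0)}$. In round $i=1,\dots,R$ the user applies a unitary map from $A^{(i-1)}\otimes T^{(i-1)}$ to $Q^{(i)}\otimes T^{(i)}$ and sends $Q^{(i)}$; the server applies a unitary map from $Q^{(i)}\otimes S^{(i-1)}$ to $A^{(i)}\otimes S^{(i)}$, may perform a projective measurement on its memory $S^{(i)}$ (the post-measurement state and the outcome stay in $S^{(i)}$), and sends $A^{(i)}$. Finally the user applies a unitary map to $A^{(R)}\otimes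 T^{(R)}$ and outputs a system of dimension $d_k$. The protocol must satisfy: * *Correctness*: for every $k$, all states $\rho_\ell$ ($\ell\ne k$), and every purification $|\psi_k\rangle$ of the $k$-th message with a reference system $R_k$, the final state of the reference system and the output is exactly $|\psi_k\rangle\langle\psi_k|$. * *User secrecy*: for all $\rho_1,\dots,\rho_F$ and every round $i$, the state of $S^{(i-1)}\otimes Q^{(i)}$ is the same for all target indices $k$. Its communication complexity is $\sum_{i=1}^R\bigl(\log_2|Q^{(i)}|+\log_2|A^{(i)}|\bigr)$. **Corollary.** For quantum messages of bounded dimension there are one-server QPIR protocols in the blind setting, with an honest server, with communication complexity $O(\log M)$ and $O(M)$ ebits of prior entanglement. Precisely: there is an absolute constant $c$, and for every $D$ there is a constant $C=C(D)$, such that for all $F$ and all $d_1,\dots,d_F\in\{1,\dots,D\}$ with $M>1$ there is such a protocol, correct and with user secrecy, with communication complexity at most $C\log_2 M$ and with at most $c\,M$ ebits of prior entanglement. -/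

import Mathlib

open scoped Kronecker ComplexOrder

/-- `ρ` is a density matrix on the system with orthonormal basis `n`. -/
def IsDensity {n : Type} [Fintype n] (ρ : Matrix n n ℂ) : Prop :=
  ρ.PosSemidef ∧ ρ.trace = 1

/-- `U` is a unitary map from the system with basis `n` to the system with basis `m`. -/
def IsUnitaryMap {m n : Type} [Fintype m] [DecidableEq m] [Fintype n] [DecidableEq n]
    (U : Matrix m n ℂ) : Prop :=
  U.conjTranspose * U = 1 ∧ U * U.conjTranspose = 1

/-- The partial trace over the second factor. -/
def traceRight {m n : Type} [Fintype n] (ρ : Matrix (m × n) (m × n) ℂ) : Matrix m m ℂ :=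
  Matrix.of fun x x' => ∑ y, ρ (x, y) (x', y)

/-- The partial trace over the first factor. -/
def traceLeft {m n : Type} [Fintype m] (ρ : Matrix (m × n) (m × n) ℂ) : Matrix n n ℂ :=
  Matrix.of fun y y' => ∑ x, ρ (x, y) (x, y')

/-- `id_R ⊗ Γ`, for a linear map `Γ` on matrices: `Γ` is applied to every block. -/
def idTensor {R m n : Type} (Γ : Matrix m m ℂ → Matrix n n ℂ)
    (ρ : Matrix (R × m) (R × m) ℂ) : Matrix (R × n) (R × n) ℂ :=
  Matrix.of fun p p' => Γ (Matrix.of fun x x' => ρ (p.1, x) (p'.1, x')) p.2 p'.2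

/-- Orthonormal basis of `X₁ ⊗ ⋯ ⊗ X_F`, where `X_ℓ` has dimension `d ℓ`. -/
abbrev MsgIdx {F : ℕ} (d : Fin F → ℕ) : Type := (ℓ : Fin F) → Fin (d ℓ)

/-- The total size of the messages, in qubits: `∑_ℓ log₂ |X_ℓ|`. -/
noncomputable def totalSize {F : ℕ} (d : Fin F → ℕ) : ℝ := ∑ ℓ, Real.logb 2 (d ℓ)

/-- A one-server, multi-round QPIR protocol in the blind setting, with prior entanglement, for
`F` messages on quantum systems `X_ℓ` of dimensions `d ℓ`. Finite-dimensional systems are given by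
finite types that index an orthonormal (computational) basis.

Before round `i + 1` the server holds `S i` and the user holds `A i ⊗ T i`. In that round
* the user applies the unitary `D i` from `A i ⊗ T i` to `Q (i+1) ⊗ T (i+1)` and sends `Q (i+1)`;
* the server applies the unitary `E i` from `Q (i+1) ⊗ S i` to `A (i+1) ⊗ S (i+1)`, performs a
  projective measurement on its memory `S (i+1)` and sends `A (i+1)`.

The operations of the server do not depend on the message states. Nothing is discarded by
the server: the outcome of its measurement is a function of the basis label of `S (i+1)`, so it stays
in the memory. A constant `out i` means that nothing is measured. -/
structure BlindQPIR {F : ℕ} (d : Fin F → ℕ) where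
  /-- number of rounds -/
  rounds : ℕ
  /-- each party has one half of a maximally entangled state on `Ent ⊗ Ent` -/
  Ent : Type
  /-- local register of the server, initially in the state `zeroS` -/
  AncS : Type
  /-- local register of the user, initially in the state `zeroT` -/
  AncT : Type
  /-- memory of the server -/
  S : ℕ → Type
  /-- queries -/
  Q : ℕ → Type
  /-- answers; `A 0` is part of the initial register of the user -/
  A : ℕ → Type
  /-- memory of the user -/
  T : ℕ → Type
  /-- the system that the user is left with, besides the output, for target index `k` -/
  W : Fin F → Type
  [fintypeEnt : Fintype Ent]
  [fintypeAncS : Fintype AncS]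
  [fintypeAncT : Fintype AncT]
  [fintypeS : ∀ i, Fintype (S i)]
  [fintypeQ : ∀ i, Fintype (Q i)]
  [fintypeA : ∀ i, Fintype (A i)]
  [fintypeT : ∀ i, Fintype (T i)]
  [fintypeW : ∀ k, Fintype (W k)]
  [decEqEnt : DecidableEq Ent]
  [decEqAncS : DecidableEq AncS]
  [decEqAncT : DecidableEq AncT]
  [decEqS : ∀ i, DecidableEq (S i)]
  [decEqQ : ∀ i, DecidableEq (Q i)]
  [decEqA : ∀ i, DecidableEq (A i)]
  [decEqT : ∀ i, DecidableEq (T i)]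
  [decEqW : ∀ k, DecidableEq (W k)]
  [nonemptyEnt : Nonempty Ent]
  zeroS : AncS
  zeroT : AncT
  /-- initially the server has the messages, its half of the entanglement, a local register -/
  initS : S 0 ≃ MsgIdx d × Ent × AncS
  /-- initially the user has the target index, its half of the entanglement, a local register -/
  initT : A 0 × T 0 ≃ Fin F × Ent × AncT
  /-- unitary maps of the user -/
  D : ∀ i, Matrix (Q (i + 1) × T (i + 1)) (A i × T i) ℂ
  /-- unitary maps of the server -/
  E : ∀ i, Matrix (A (i + 1) × S (i + 1)) (Q (i + 1) × S i) ℂ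
  /-- measurement of the server: its outcome, read off from the basis label of the memory -/
  out : ∀ i, S (i + 1) → ℕ
  /-- final unitary map of the user; its output system is a copy of the target system `X_k`, so it
  is given for each `k` -/
  Dfin : ∀ k, Matrix (Fin (d k) × W k) (A rounds × T rounds) ℂ
  unitary_D : ∀ i < rounds, IsUnitaryMap (D i)
  unitary_E : ∀ i < rounds, IsUnitaryMap (E i)
  unitary_Dfin : ∀ k, IsUnitaryMap (Dfin k)

attribute [instance] BlindQPIR.fintypeEnt BlindQPIR.fintypeAncS BlindQPIR.fintypeAncT
  BlindQPIR.fintypeS BlindQPIR.fintypeQ BlindQPIR.fintypeA BlindQPIR.fintypeT BlindQPIR.fintypeW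
  BlindQPIR.decEqEnt BlindQPIR.decEqAncS BlindQPIR.decEqAncT
  BlindQPIR.decEqS BlindQPIR.decEqQ BlindQPIR.decEqA BlindQPIR.decEqT BlindQPIR.decEqW
  BlindQPIR.nonemptyEnt

namespace BlindQPIR

variable {F : ℕ} {d : Fin F → ℕ} (P : BlindQPIR d)

/-- Amplitudes of the joint initial state of all registers other than the messages:
`|0⟩ ⊗ |k⟩ ⊗ |0⟩ ⊗ |Ent|^{-1/2} ∑_e |e⟩|e⟩`. -/
noncomputable def initAmp (k : Fin F) (p : P.S 0 × P.A 0 × P.T 0) : ℂ :=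
  if (P.initS p.1).2.2 = P.zeroS ∧ (P.initT p.2).1 = k ∧ (P.initT p.2).2.2 = P.zeroT ∧
      (P.initS p.1).2.1 = (P.initT p.2).2.1
  then ((Real.sqrt (Fintype.card P.Ent))⁻¹ : ℝ) else 0

/-- The joint initial state, for messages in the joint state `σ` and target index `k`. -/
noncomputable def initState (k : Fin F) (σ : Matrix (MsgIdx d) (MsgIdx d) ℂ) :
    Matrix (P.S 0 × P.A 0 × P.T 0) (P.S 0 × P.A 0 × P.T 0) ℂ :=
  Matrix.of fun p p' => σ (P.initS p.1).1 (P.initS p'.1).1 * (P.initAmp k p * star (P.initAmp k p'))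

/-- The user applies `D i`. -/
noncomputable def userStep (i : ℕ) (ρ : Matrix (P.S i × P.A i × P.T i) (P.S i × P.A i × P.T i) ℂ) :
    Matrix (P.S i × P.Q (i + 1) × P.T (i + 1)) (P.S i × P.Q (i + 1) × P.T (i + 1)) ℂ :=
  ((1 : Matrix (P.S i) (P.S i) ℂ) ⊗ₖ P.D i) * ρ *
    ((1 : Matrix (P.S i) (P.S i) ℂ) ⊗ₖ P.D i).conjTranspose

/-- The server applies `E i` to `Q (i+1) ⊗ S i`. -/
noncomputable def serverUnitary (i : ℕ)
    (ρ : Matrix (P.S i × P.Q (i + 1) × P.T (i + 1)) (P.S i × P.Q (i + 1) × P.T (i + 1)) ℂ) :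
    Matrix ((P.A (i + 1) × P.S (i + 1)) × P.T (i + 1))
      ((P.A (i + 1) × P.S (i + 1)) × P.T (i + 1)) ℂ :=
  (P.E i ⊗ₖ (1 : Matrix (P.T (i + 1)) (P.T (i + 1)) ℂ)) *
    ρ.submatrix (fun p : (P.Q (i + 1) × P.S i) × P.T (i + 1) => (p.1.2, p.1.1, p.2))
      (fun p : (P.Q (i + 1) × P.S i) × P.T (i + 1) => (p.1.2, p.1.1, p.2)) *
    (P.E i ⊗ₖ (1 : Matrix (P.T (i + 1)) (P.T (i + 1)) ℂ)).conjTranspose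

/-- The server applies `E i` and measures its memory: the state becomes `∑_o Π_o ρ Π_o`, where `Π_o`
projects on the basis vectors `|s⟩` of `S (i+1)` with `out i s = o`. -/
noncomputable def serverStep (i : ℕ)
    (ρ : Matrix (P.S i × P.Q (i + 1) × P.T (i + 1)) (P.S i × P.Q (i + 1) × P.T (i + 1)) ℂ) :
    Matrix (P.S (i + 1) × P.A (i + 1) × P.T (i + 1))
      (P.S (i + 1) × P.A (i + 1) × P.T (i + 1)) ℂ :=
  Matrix.of fun p p' => if P.out i p.1 = P.out i p'.1 then
    P.serverUnitary i ρ ((p.2.1, p.1), p.2.2) ((p'.2.1, p'.1), p'.2.2) else 0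

/-- The joint state after `i` rounds. -/
noncomputable def state (k : Fin F) (σ : Matrix (MsgIdx d) (MsgIdx d) ℂ) :
    (i : ℕ) → Matrix (P.S i × P.A i × P.T i) (P.S i × P.A i × P.T i) ℂ
  | 0 => P.initState k σ
  | i + 1 => P.serverStep i (P.userStep i (state k σ i))

/-- The state on `S i ⊗ Q (i+1)`, all that the server has when the query of round `i + 1` arrives. -/
noncomputable def serverView (k : Fin F) (σ : Matrix (MsgIdx d) (MsgIdx d) ℂ) (i : ℕ) :
    Matrix (P.S i × P.Q (i + 1)) (P.S i × P.Q (i + 1)) ℂ :=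
  traceRight ((P.userStep i (P.state k σ i)).submatrix
    (fun p : (P.S i × P.Q (i + 1)) × P.T (i + 1) => (p.1.1, p.1.2, p.2))
    (fun p : (P.S i × P.Q (i + 1)) × P.T (i + 1) => (p.1.1, p.1.2, p.2)))

/-- The input-output map from `X₁ ⊗ ⋯ ⊗ X_F` to `X_k` for the target index `k`: the output system
of the final unitary map of the user, all other systems being traced out. -/
noncomputable def channel (k : Fin F) (σ : Matrix (MsgIdx d) (MsgIdx d) ℂ) :
    Matrix (Fin (d k)) (Fin (d k)) ℂ :=
  traceRight (P.Dfin k * traceLeft (P.state k σ P.rounds) * (P.Dfin k).conjTranspose)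

/-- Correctness: for all states `ρ ℓ` of the messages `ℓ ≠ k`, and all states of the message `k`,
purified to `|ψ⟩` with any reference system `R`, the output together with `R` is in the state
`|ψ⟩⟨ψ|`. -/
def Correct : Prop :=
  ∀ (k : Fin F) (ρ : (ℓ : Fin F) → Matrix (Fin (d ℓ)) (Fin (d ℓ)) ℂ), (∀ ℓ, IsDensity (ρ ℓ)) →
    ∀ (R : Type) [Fintype R] (ψ : R × Fin (d k) → ℂ), ∑ p, ‖ψ p‖ ^ 2 = 1 →
      idTensor (P.channel k)
        (Matrix.of fun (p p' : R × MsgIdx d) => (∏ ℓ ∈ Finset.univ.erase k, ρ ℓ (p.2 ℓ) (p'.2 ℓ)) *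
          (ψ (p.1, p.2 k) * star (ψ (p'.1, p'.2 k)))) =
        Matrix.of fun q q' => ψ q * star (ψ q')

/-- User secrecy: for all message states `ρ 1 ⊗ ⋯ ⊗ ρ F`, what the server has in any round does not
depend on the target index. -/
def Secret : Prop :=
  ∀ ρ : (ℓ : Fin F) → Matrix (Fin (d ℓ)) (Fin (d ℓ)) ℂ, (∀ ℓ, IsDensity (ρ ℓ)) →
    ∀ (k k' : Fin F), ∀ i < P.rounds,
      P.serverView k (Matrix.of fun x x' => ∏ ℓ, ρ ℓ (x ℓ) (x' ℓ)) i =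
        P.serverView k' (Matrix.of fun x x' => ∏ ℓ, ρ ℓ (x ℓ) (x' ℓ)) i

/-- Communication complexity: the total number of qubits sent in either direction. -/
noncomputable def commComplexity : ℝ :=
  ∑ i ∈ Finset.range P.rounds,
    (Real.logb 2 (Fintype.card (P.Q (i + 1))) + Real.logb 2 (Fintype.card (P.A (i + 1))))

/-- Prior entanglement in ebits: a maximally entangled state on `ℂ^e ⊗ ℂ^e` counts `log₂ e`. -/
noncomputable def ebits : ℝ := Real.logb 2 (Fintype.card P.Ent)

end BlindQPIR

/-! The protocol teleports all messages at once and lets the user retrieve one teleportation label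
privately. A Bell measurement on the messages and the server's half of a maximally entangled state
leaves the user with a Weyl operator, given by a random label `m ℓ`, applied to each message `ℓ`. To
recover message `k` only the label of `k` is needed, which has a bounded number of bits when the
dimensions are bounded. The other messages stay encrypted and are traced out.

The labels are written on a cyclic tape of N = O(M) bits. Further entanglement supplies, in
superposition, a pad `z` of N bits and a shift `s` in the cyclic group. In its first operation the
honest server replaces its copy of the pad by `z` plus the tape shifted by `s`, and hands its copy
of `s` to the user. The user returns the cell `s + start k`, and the server sends a window of the
padded tape at that cell. The user subtracts the same window of `z`, decodes the label and undoes
the Weyl operator (`decode_window`). Only cells and windows travel, so each message costs log N +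
O(1) qubits, while the entanglement is M + N + log N ebits.

Secrecy: the server sees the label, the padded tape `z + c.shifted m s` and the cell `s + start k`.
A change of target is absorbed by a change of `s` and then of `z`, that is, by a bijection of the
user's basis labels, over which the trace is taken (`amp₂_relabel`).

Correctness: all states are written as `krausMap K σ` with explicit amplitudes `K`. After the
correction each nonzero Kraus operator is the identity on message `k` tensored with a row of a
unitary matrix on the others, so the channel is exactly the partial trace (`protocol_channel`). -/

open Matrix

/-! ### Unitary maps -/

namespace IsUnitaryMap

variable {l m n o : Type} [Fintype l] [DecidableEq l] [Fintype m] [DecidableEq m]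
  [Fintype n] [DecidableEq n] [Fintype o] [DecidableEq o]

theorem one : IsUnitaryMap (1 : Matrix m m ℂ) := by simp [IsUnitaryMap]

theorem conjTranspose {U : Matrix m n ℂ} (h : IsUnitaryMap U) : IsUnitaryMap Uᴴ := by
  simpa [IsUnitaryMap] using h.symm

theorem submatrix {U : Matrix m n ℂ} (h : IsUnitaryMap U) (e : l ≃ m) (f : o ≃ n) :
    IsUnitaryMap (U.submatrix e f) := by
  constructor
  · rw [conjTranspose_submatrix, submatrix_mul_equiv, h.1, submatrix_one_equiv]
  · rw [conjTranspose_submatrix, submatrix_mul_equiv, h.2, submatrix_one_equiv]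

theorem kronecker_one {U : Matrix m n ℂ} (h : IsUnitaryMap U) :
    IsUnitaryMap (U ⊗ₖ (1 : Matrix o o ℂ)) := by
  constructor
  · rw [conjTranspose_kronecker, ← mul_kronecker_mul, h.1]; simp
  · rw [conjTranspose_kronecker, ← mul_kronecker_mul, h.2]; simp

theorem blockDiagonal {U : o → Matrix m n ℂ} (h : ∀ i, IsUnitaryMap (U i)) :
    IsUnitaryMap (blockDiagonal U) := by
  constructor
  · rw [blockDiagonal_conjTranspose, ← blockDiagonal_mul, ← blockDiagonal_one]
    exact congrArg _ (funext fun i => (h i).1)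
  · rw [blockDiagonal_conjTranspose, ← blockDiagonal_mul, ← blockDiagonal_one]
    exact congrArg _ (funext fun i => (h i).2)

end IsUnitaryMap

/-! ### Maps in Kraus form -/

section Kraus

variable {ι κ X P R : Type} [Fintype ι] [Fintype κ] [Fintype X]

/-- The map `σ ↦ ∑ i, K i σ (K i)ᴴ`. -/
noncomputable def krausMap (K : ι → Matrix P X ℂ) (σ : Matrix X X ℂ) : Matrix P P ℂ :=
  ∑ i, K i * σ * (K i)ᴴ

theorem krausMap_apply (K : ι → Matrix P X ℂ) (σ : Matrix X X ℂ) (p p' : P) :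
    krausMap K σ p p' = ∑ i, (K i * σ * (K i)ᴴ) p p' := by
  simp [krausMap, Matrix.sum_apply]

theorem mul_krausMap_mul [Fintype P] (U : Matrix R P ℂ) (K : ι → Matrix P X ℂ)
    (σ : Matrix X X ℂ) :
    U * krausMap K σ * Uᴴ = krausMap (fun i => U * K i) σ := by
  simp only [krausMap, Matrix.mul_sum, Matrix.sum_mul, conjTranspose_mul, Matrix.mul_assoc]

theorem submatrix_krausMap (f : R → P) (K : ι → Matrix P X ℂ) (σ : Matrix X X ℂ) :
    (krausMap K σ).submatrix f f = krausMap (fun i => (K i).submatrix f id) σ := by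
  ext r r'
  simp only [submatrix_apply, krausMap_apply, Matrix.mul_apply, conjTranspose_apply, id]

/-- Secrecy rests on this: two views of the server agree once a bijection matches their Kraus
operators. -/
theorem krausMap_equiv (e : ι ≃ κ) (K : κ → Matrix P X ℂ) (σ : Matrix X X ℂ) :
    krausMap (fun i => K (e i)) σ = krausMap K σ :=
  e.sum_comp fun i => K i * σ * (K i)ᴴ

theorem krausMap_of_injective (f : ι → κ) (hf : f.Injective) (K : κ → Matrix P X ℂ)
    (hK : ∀ j ∉ Set.range f, K j = 0) (σ : Matrix X X ℂ) :
    krausMap K σ = krausMap (fun i => K (f i)) σ :=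
  (Fintype.sum_of_injective f hf _ _ (fun j hj => by simp [hK j hj]) fun _ => rfl).symm

theorem traceRight_krausMap {Y : Type} [Fintype Y] (K : ι → Matrix (P × Y) X ℂ)
    (σ : Matrix X X ℂ) :
    traceRight (krausMap K σ) =
      krausMap (fun i : ι × Y => (K i.1).submatrix (fun p => (p, i.2)) id) σ := by
  ext p p'
  simp only [traceRight, of_apply, krausMap_apply, Fintype.sum_prod_type, Matrix.mul_apply,
    conjTranspose_apply, submatrix_apply, id]
  rw [Finset.sum_comm]

theorem traceLeft_krausMap {Y : Type} [Fintype Y] (K : ι → Matrix (Y × P) X ℂ)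
    (σ : Matrix X X ℂ) :
    traceLeft (krausMap K σ) =
      krausMap (fun i : ι × Y => (K i.1).submatrix (fun p => (i.2, p)) id) σ := by
  ext p p'
  simp only [traceLeft, of_apply, krausMap_apply, Fintype.sum_prod_type, Matrix.mul_apply,
    conjTranspose_apply, submatrix_apply, id]
  rw [Finset.sum_comm]

/-- The Kraus operators of the measured map are the products of a projector onto the labels with
outcome `o` and `K i`. An entry survives for some `o` exactly when both labels have the same
outcome. -/
theorem dephase_krausMap {O : Type} [Fintype O] [DecidableEq O] (f : P → O)
    (K : ι → Matrix P X ℂ) (σ : Matrix X X ℂ) :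
    (of fun p p' => if f p = f p' then krausMap K σ p p' else 0) =
      krausMap (fun i : ι × O => of fun p x => if f p = i.2 then K i.1 p x else 0) σ := by
  ext p p'
  have h (o : O) (i : ι) : ((of fun p x => if f p = o then K i p x else 0) * σ *
      (of fun p x => if f p = o then K i p x else 0)ᴴ) p p' =
      if f p = o then (if f p' = o then (K i * σ * (K i)ᴴ) p p' else 0) else 0 := by
    by_cases h1 : f p = o <;> by_cases h2 : f p' = o <;>
      simp [Matrix.mul_apply, conjTranspose_apply, of_apply, h1, h2]
  rw [krausMap_apply, Fintype.sum_prod_type, of_apply, krausMap_apply]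
  simp only [h, Finset.sum_ite_eq, Finset.mem_univ, if_true]
  by_cases h1 : f p = f p'
  · simp [h1]
  · simp [h1, Ne.symm h1]

end Kraus

/-! ### Evolution of the amplitudes in a protocol -/

namespace BlindQPIR

variable {F : ℕ} {d : Fin F → ℕ} (P : BlindQPIR d) {ι X : Type} [Fintype ι] [Fintype X]

theorem initState_eq_krausMap (k : Fin F) (σ : Matrix (MsgIdx d) (MsgIdx d) ℂ) :
    P.initState k σ = krausMap (fun _ : Unit => of fun p x =>
      if x = (P.initS p.1).1 then P.initAmp k p else 0) σ := by
  ext p p'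
  simp only [krausMap_apply, initState, of_apply, Finset.univ_unique, Finset.sum_singleton,
    Matrix.mul_apply, conjTranspose_apply, ite_mul, zero_mul, Finset.sum_ite_eq', Finset.mem_univ,
    if_true, apply_ite star, star_zero, mul_ite, mul_zero]
  ring

theorem userStep_krausMap (i : ℕ) (K : ι → Matrix (P.S i × P.A i × P.T i) X ℂ)
    (σ : Matrix X X ℂ) :
    P.userStep i (krausMap K σ) = krausMap (fun j => of fun p x =>
      ∑ r, P.D i p.2 r * K j (p.1, r) x) σ := by
  rw [userStep, mul_krausMap_mul]
  congr 1
  funext j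
  ext p x
  simp [Matrix.mul_apply, Fintype.sum_prod_type, Matrix.one_apply]

theorem serverUnitary_krausMap (i : ℕ) (K : ι → Matrix (P.S i × P.Q (i + 1) × P.T (i + 1)) X ℂ)
    (σ : Matrix X X ℂ) :
    P.serverUnitary i (krausMap K σ) = krausMap (fun j => of fun p x =>
      ∑ r : P.Q (i + 1) × P.S i, P.E i p.1 r * K j (r.2, r.1, p.2) x) σ := by
  rw [serverUnitary, submatrix_krausMap, mul_krausMap_mul]
  congr 1
  funext j
  ext p x
  simp [Matrix.mul_apply, Fintype.sum_prod_type, Matrix.one_apply]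

/-- Only the level sets of `out` matter, so a map `f` to a finite type can take its place and index
the outcomes. -/
theorem serverStep_krausMap (i : ℕ) {O : Type} [Fintype O] [DecidableEq O] (f : P.S (i + 1) → O)
    (hf : ∀ s s', P.out i s = P.out i s' ↔ f s = f s')
    (K : ι → Matrix (P.S i × P.Q (i + 1) × P.T (i + 1)) X ℂ) (σ : Matrix X X ℂ) :
    P.serverStep i (krausMap K σ) = krausMap (fun j : ι × O => of fun p x =>
      if f p.1 = j.2 then ∑ r : P.Q (i + 1) × P.S i, P.E i (p.2.1, p.1) r *
        K j.1 (r.2, r.1, p.2.2) x else 0) σ := by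
  refine Eq.trans ?_ (dephase_krausMap (fun p : P.S (i + 1) × P.A (i + 1) × P.T (i + 1) => f p.1)
    (fun j => of fun p x => ∑ r : P.Q (i + 1) × P.S i, P.E i (p.2.1, p.1) r *
        K j (r.2, r.1, p.2.2) x) σ)
  rw [serverStep, serverUnitary_krausMap]
  ext p p'
  simp only [of_apply, hf]
  congr 1
  simp only [krausMap_apply, Matrix.mul_apply, conjTranspose_apply, of_apply]

theorem serverView_krausMap (k : Fin F) (σ : Matrix (MsgIdx d) (MsgIdx d) ℂ) (i : ℕ)
    (K : ι → Matrix (P.S i × P.A i × P.T i) (MsgIdx d) ℂ) (h : P.state k σ i = krausMap K σ) :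
    P.serverView k σ i = krausMap (fun j : ι × P.T (i + 1) => of fun p x =>
      ∑ r, P.D i (p.2, j.2) r * K j.1 (p.1, r) x) σ := by
  rw [serverView, h, userStep_krausMap, submatrix_krausMap, traceRight_krausMap]
  rfl

theorem channel_krausMap (k : Fin F) (σ : Matrix (MsgIdx d) (MsgIdx d) ℂ)
    (K : ι → Matrix (P.S P.rounds × P.A P.rounds × P.T P.rounds) (MsgIdx d) ℂ)
    (h : P.state k σ P.rounds = krausMap K σ) :
    P.channel k σ = krausMap (fun j : (ι × P.S P.rounds) × P.W k => of fun o x =>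
      ∑ r, P.Dfin k (o, j.2) r * K j.1.1 (j.1.2, r) x) σ := by
  rw [channel, h, traceLeft_krausMap, mul_krausMap_mul, traceRight_krausMap]
  rfl

end BlindQPIR

/-! ### Weyl operators and the generalized Bell basis -/

/-- The Weyl operator `X^a Z^b` on `ℂ^n`, for `g = (a, b)`. -/
noncomputable def weyl (n : ℕ) (g : Fin n × Fin n) : Matrix (Fin n) (Fin n) ℂ :=
  of fun e x => if (e : ℕ) = (x + g.1) % n then
    Complex.exp (2 * Real.pi * Complex.I / n) ^ ((g.2 : ℕ) * x) else 0

theorem star_exp_mul_self (n : ℕ) :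
    star (Complex.exp (2 * Real.pi * Complex.I / n)) * Complex.exp (2 * Real.pi * Complex.I / n)
      = 1 := by
  rw [Complex.star_def, ← Complex.exp_conj, ← Complex.exp_add]
  have h : (starRingEnd ℂ) 2 = 2 := Complex.conj_ofNat 2
  simp [h, neg_div]

theorem sum_weyl_mul (n : ℕ) (g : Fin n × Fin n) (x : Fin n) (f : Fin n → ℂ) :
    ∑ e, weyl n g e x * f e = Complex.exp (2 * Real.pi * Complex.I / n) ^ ((g.2 : ℕ) * x) *
      f ⟨(x + g.1) % n, Nat.mod_lt _ x.pos⟩ := by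
  rw [Finset.sum_eq_single ⟨(x + g.1) % n, Nat.mod_lt _ x.pos⟩]
  · simp [weyl]
  · intro e _ he
    rw [weyl, of_apply, if_neg, zero_mul]
    exact fun h => he (Fin.ext h)
  · simp

theorem weyl_unitary (n : ℕ) (g : Fin n × Fin n) : IsUnitaryMap (weyl n g) := by
  have h : (weyl n g)ᴴ * weyl n g = 1 := by
    ext x x'
    have h1 : ((weyl n g)ᴴ * weyl n g) x x' = ∑ e, weyl n g e x' * star (weyl n g e x) := by
      rw [Matrix.mul_apply]
      exact Finset.sum_congr rfl fun e _ => mul_comm _ _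
    rw [h1, sum_weyl_mul]
    simp only [weyl, of_apply, Matrix.one_apply]
    by_cases hx : x = x'
    · subst hx
      rw [if_pos rfl, if_pos rfl, mul_comm, star_pow, ← mul_pow, star_exp_mul_self, one_pow]
    · rw [if_neg hx, if_neg, star_zero, mul_zero]
      intro h
      have h2 : (x' : ℕ) ≡ x [MOD n] := Nat.ModEq.add_right_cancel' _ h
      exact hx (Fin.ext (Nat.ModEq.eq_of_lt_of_lt h2 x'.2 x.2).symm)
  exact ⟨h, mul_eq_one_comm.1 h⟩

/-- Different shifts have disjoint supports. For equal shifts the sum is a geometric series in an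
`n`-th root of unity, which vanishes unless the root is 1, that is, unless the phases agree. -/
theorem sum_weyl_mul_star_weyl (n : ℕ) (g g' : Fin n × Fin n) :
    ∑ x, ∑ e, weyl n g e x * star (weyl n g' e x) = if g = g' then (n : ℂ) else 0 := by
  simp only [sum_weyl_mul]
  set w := Complex.exp (2 * Real.pi * Complex.I / n) with hw
  have hw1 : star w * w = 1 := star_exp_mul_self n
  rcases Nat.eq_zero_or_pos n with rfl | hn
  · exact g.1.elim0
  by_cases ha : g.1 = g'.1
  · have h1 (x : Fin n) : w ^ ((g.2 : ℕ) * x) *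
        star (weyl n g' ⟨(x + g.1) % n, Nat.mod_lt _ x.pos⟩ x) =
        (w ^ (g.2 : ℕ) * star w ^ (g'.2 : ℕ)) ^ (x : ℕ) := by
      simp [weyl, ha, ← hw, mul_pow, pow_mul]
    simp only [h1]
    rw [Fin.sum_univ_eq_sum_range fun i => (w ^ (g.2 : ℕ) * star w ^ (g'.2 : ℕ)) ^ i]
    by_cases hb : g.2 = g'.2
    · have h2 : w ^ (g.2 : ℕ) * star w ^ (g'.2 : ℕ) = 1 := by
        rw [hb, ← mul_pow, mul_comm, hw1, one_pow]
      simp only [h2, one_pow, if_pos (Prod.ext ha hb)]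
      simp
    · have hp : IsPrimitiveRoot w n := Complex.isPrimitiveRoot_exp n hn.ne'
      have h2 : w ^ (g.2 : ℕ) * star w ^ (g'.2 : ℕ) ≠ 1 := by
        intro h
        refine hb (Fin.ext (hp.pow_inj g.2.2 g'.2.2 ?_))
        calc w ^ (g.2 : ℕ) = (w ^ (g.2 : ℕ) * star w ^ (g'.2 : ℕ)) * w ^ (g'.2 : ℕ) := by
              rw [mul_assoc, ← mul_pow, hw1, one_pow, mul_one]
          _ = _ := by rw [h, one_mul]
      have h3 : (w ^ (g.2 : ℕ) * star w ^ (g'.2 : ℕ)) ^ n = 1 := by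
        rw [mul_pow, ← pow_mul, ← pow_mul, mul_comm _ n, mul_comm _ n, pow_mul, pow_mul, ← star_pow,
          hp.pow_eq_one]
        simp
      rw [geom_sum_eq h2, h3, sub_self, zero_div, if_neg]
      exact fun h => hb (by rw [h])
  · rw [if_neg fun h => ha (by rw [h])]
    refine Finset.sum_eq_zero fun x _ => ?_
    rw [weyl, of_apply, if_neg, star_zero, mul_zero]
    intro h
    have h2 : (g.1 : ℕ) ≡ g'.1 [MOD n] := Nat.ModEq.add_left_cancel' _ h
    exact ha (Fin.ext (Nat.ModEq.eq_of_lt_of_lt h2 g.1.2 g'.1.2))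

section Bell

variable {F : ℕ} (d : Fin F → ℕ)

/-- Matrix entries of the tensor product of the Weyl operators with labels `m`. -/
noncomputable def weylProd (m : MsgIdx d × MsgIdx d) (e x : MsgIdx d) : ℂ :=
  ∏ ℓ, weyl (d ℓ) (m.1 ℓ, m.2 ℓ) (e ℓ) (x ℓ)

/-- The unitary map from `X ⊗ X` to itself that takes the generalized Bell basis to the
computational basis. -/
noncomputable def bell : Matrix (MsgIdx d × MsgIdx d) (MsgIdx d × MsgIdx d) ℂ :=
  of fun m p => ((Real.sqrt (Fintype.card (MsgIdx d)))⁻¹ : ℝ) * weylProd d m p.2 p.1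

theorem sum_weylProd_mul_star (m m' : MsgIdx d × MsgIdx d) :
    ∑ p : MsgIdx d × MsgIdx d, weylProd d m p.2 p.1 * star (weylProd d m' p.2 p.1) =
      if m = m' then (Fintype.card (MsgIdx d) : ℂ) else 0 := by
  calc _ = ∏ ℓ, ∑ p : Fin (d ℓ) × Fin (d ℓ), weyl (d ℓ) (m.1 ℓ, m.2 ℓ) p.2 p.1 *
          star (weyl (d ℓ) (m'.1 ℓ, m'.2 ℓ) p.2 p.1) := by
        rw [Finset.prod_univ_sum, Fintype.piFinset_univ]
        refine Fintype.sum_equiv (Equiv.arrowProdEquivProdArrow _ _ _).symm _ _ fun p => ?_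
        simp [weylProd, star_prod, Finset.prod_mul_distrib, Equiv.arrowProdEquivProdArrow]
    _ = ∏ ℓ, if (m.1 ℓ, m.2 ℓ) = (m'.1 ℓ, m'.2 ℓ) then (d ℓ : ℂ) else 0 := by
        simp only [Fintype.sum_prod_type, sum_weyl_mul_star_weyl]
    _ = _ := by
        by_cases h : m = m'
        · simp [h]
        · rw [if_neg h]
          obtain ⟨ℓ, hℓ⟩ : ∃ ℓ, (m.1 ℓ, m.2 ℓ) ≠ (m'.1 ℓ, m'.2 ℓ) := by
            by_contra! hc
            simp only [Prod.mk.injEq] at hc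
            exact h (Prod.ext (funext fun ℓ => (hc ℓ).1) (funext fun ℓ => (hc ℓ).2))
          exact Finset.prod_eq_zero (Finset.mem_univ ℓ) (if_neg hℓ)

theorem inv_sqrt_mul_self (n : ℕ) :
    (((Real.sqrt n)⁻¹ : ℝ) : ℂ) * (((Real.sqrt n)⁻¹ : ℝ) : ℂ) = (n : ℂ)⁻¹ := by
  rw [← Complex.ofReal_mul, ← mul_inv, Real.mul_self_sqrt n.cast_nonneg]
  simp

theorem bell_unitary : IsUnitaryMap (bell d) := by
  -- The rows are orthonormal by orthogonality of the Weyl operators; for a square matrix this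
  -- suffices.
  have h : bell d * (bell d)ᴴ = 1 := by
    ext m m'
    have h1 : (bell d * (bell d)ᴴ) m m' = (Fintype.card (MsgIdx d) : ℂ)⁻¹ *
        ∑ p : MsgIdx d × MsgIdx d, weylProd d m p.2 p.1 * star (weylProd d m' p.2 p.1) := by
      rw [Matrix.mul_apply, Finset.mul_sum, ← inv_sqrt_mul_self]
      refine Finset.sum_congr rfl fun p _ => ?_
      simp only [bell, of_apply, conjTranspose_apply, star_mul', Complex.star_def,
        Complex.conj_ofReal]
      ring
    rw [h1, sum_weylProd_mul_star, Matrix.one_apply]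
    split_ifs
    · refine inv_mul_cancel₀ (Nat.cast_ne_zero.2 ?_)
      exact (Fintype.card_pos_iff.2 ⟨m.1⟩).ne'
    · simp
  exact ⟨mul_eq_one_comm.1 h, h⟩

end Bell

/-! ### The protocol -/

/-- A layout of labels `m` of generalized Bell states, one for each message, on a cyclic tape of
bits: the cells of the tape form a group `Cell`, and the label of message `ℓ` can be read off from
the `width` bits at the cells `start ℓ + off j`. -/
structure BitLayout {F : ℕ} (d : Fin F → ℕ) where
  Cell : Type
  [group : AddCommGroup Cell]
  [fintype : Fintype Cell]
  [decEq : DecidableEq Cell]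
  width : ℕ
  off : Fin width → Cell
  start : Fin F → Cell
  tape : MsgIdx d × MsgIdx d → Cell → ZMod 2
  decode : ∀ k, (Fin width → ZMod 2) → Fin (d k) × Fin (d k)
  decode_tape : ∀ k m, decode k (fun j => tape m (start k + off j)) = (m.1 k, m.2 k)

attribute [instance] BitLayout.group BitLayout.fintype BitLayout.decEq

namespace BitLayout

variable {F : ℕ} {d : Fin F → ℕ} (c : BitLayout d)

/-- The contents of a tape. -/
abbrev Tape : Type := c.Cell → ZMod 2

/-- What is sent in each direction: a cell and a window of the tape. -/
abbrev Comm : Type := c.Cell × (Fin c.width → ZMod 2)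

/-- The shared entanglement: for teleportation, for a pad of the tape, for a random shift. -/
abbrev Ent : Type := MsgIdx d × c.Tape × c.Cell

/-- The memory of the server. -/
abbrev Srv : Type := MsgIdx d × c.Ent

/-- The memory of the user. -/
abbrev Usr : Type := Fin F × c.Ent


/-- The system that the user is left with besides the output. -/
abbrev Rest (k : Fin F) : Type :=
  ((ℓ : {ℓ : Fin F // ℓ ≠ k}) → Fin (d ℓ)) × c.Comm × Fin F × c.Tape × c.Cell

instance : DecidableEq c.Ent := inferInstance
instance : DecidableEq (c.Comm × c.Srv) := inferInstance
instance : DecidableEq (c.Comm × c.Usr) := inferInstance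
instance : DecidableEq (c.Comm × c.Tape × c.Cell) := inferInstance
instance (k : Fin F) : DecidableEq (c.Rest k) :=
  have : DecidableEq (c.Comm × Fin F × c.Tape × c.Cell) := inferInstance
  inferInstance

/-- The window of a tape at the cell `q`. -/
def window (w : c.Tape) (q : c.Cell) : Fin c.width → ZMod 2 := fun j => w (q + c.off j)

/-- The tape with the labels `m`, shifted by `a`. -/
def shifted (m : MsgIdx d × MsgIdx d) (a : c.Cell) : c.Tape := fun p => c.tape m (p - a)

/-- The pad cancels in the difference of the windows, and the shift cancels in the address: what
remains are the bits of `c.tape m` from the cell `c.start k` on. -/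
theorem decode_window (k : Fin F) (m : MsgIdx d × MsgIdx d) (z : c.Tape) (a : c.Cell) :
    c.decode k (c.window (z + c.shifted m a) (a + c.start k) - c.window z (a + c.start k)) =
      (m.1 k, m.2 k) := by
  rw [← c.decode_tape k m]
  congr 1
  funext j
  simp only [window, shifted, Pi.sub_apply, Pi.add_apply, add_sub_cancel_left]
  congr 1
  abel

/-- Registers of the server after its first operation, in terms of those after the Bell
transformation: the tape is added to the pad and the shift is moved to the answer. -/
def padEquiv : c.Comm × c.Srv ≃ (MsgIdx d × MsgIdx d) × (c.Comm × c.Tape × c.Cell) where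
  toFun p := ((p.2.1, p.2.2.1),
    ((p.2.2.2.2, p.1.2), p.2.2.2.1 - c.shifted (p.2.1, p.2.2.1) p.1.1, p.1.1))
  invFun p := ((p.2.2.2, p.2.1.2), (p.1.1, p.1.2, p.2.2.1 + c.shifted p.1 p.2.2.2, p.2.1.1))
  left_inv p := by simp
  right_inv p := by simp

/-- Registers of the server, with those for the Bell transformation in front. -/
def bellEquiv : c.Comm × c.Srv ≃ (MsgIdx d × MsgIdx d) × (c.Comm × c.Tape × c.Cell) where
  toFun p := ((p.2.1, p.2.2.1), (p.1, p.2.2.2))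
  invFun p := (p.2.1, (p.1.1, p.1.2, p.2.2))
  left_inv _ := rfl
  right_inv _ := rfl

/-- First operation of the server. -/
noncomputable def teleport : Matrix (c.Comm × c.Srv) (c.Comm × c.Srv) ℂ :=
  (bell d ⊗ₖ (1 : Matrix (c.Comm × c.Tape × c.Cell) (c.Comm × c.Tape × c.Cell) ℂ)).submatrix
    c.padEquiv c.bellEquiv

/-- Inverse of the second operation of the user: it adds the address of the target to the shift. -/
def queryEquiv : c.Comm × c.Usr ≃ c.Comm × c.Usr where
  toFun p := ((p.1.1 - c.start p.2.1, p.1.2), p.2)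
  invFun p := ((p.1.1 + c.start p.2.1, p.1.2), p.2)
  left_inv p := by simp
  right_inv p := by simp

/-- Inverse of the second operation of the server: it adds a window of the padded tape to the
answer. -/
def answerEquiv : c.Comm × c.Srv ≃ c.Comm × c.Srv where
  toFun p := ((p.1.1, p.1.2 - c.window p.2.2.2.1 p.1.1), p.2)
  invFun p := ((p.1.1, p.1.2 + c.window p.2.2.2.1 p.1.1), p.2)
  left_inv p := by simp
  right_inv p := by simp

/-- Registers of the user, with the target system in front. -/
def targetEquiv (k : Fin F) : c.Comm × c.Usr ≃ Fin (d k) × c.Rest k where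
  toFun p := ((Equiv.piSplitAt k fun ℓ => Fin (d ℓ)) p.2.2.1 |>.1,
    ((Equiv.piSplitAt k fun ℓ => Fin (d ℓ)) p.2.2.1 |>.2, p.1, p.2.1, p.2.2.2))
  invFun p := (p.2.2.1, p.2.2.2.1, (Equiv.piSplitAt k fun ℓ => Fin (d ℓ)).symm (p.1, p.2.1),
    p.2.2.2.2)
  left_inv p := by
    simp only [Prod.mk.eta, Equiv.symm_apply_apply]
  right_inv p := by simp

/-- The label of the Weyl operator that the user undoes. -/
def label (k : Fin F) (r : c.Rest k) : Fin (d k) × Fin (d k) :=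
  c.decode k (r.2.1.2 - c.window r.2.2.2.1 r.2.1.1)

/-- Last operation of the user. -/
noncomputable def correction (k : Fin F) : Matrix (Fin (d k) × c.Rest k) (c.Comm × c.Usr) ℂ :=
  (blockDiagonal fun r => (weyl (d k) (c.label k r))ᴴ).submatrix id (c.targetEquiv k)

/-- The protocol: teleportation of all messages, and retrieval of one label from a padded and
shifted tape of labels. -/
noncomputable def protocol [∀ ℓ, NeZero (d ℓ)] : BlindQPIR d where
  rounds := 2
  Ent := c.Ent
  AncS := Unit
  AncT := c.Comm
  S _ := c.Srv
  Q _ := c.Comm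
  A _ := c.Comm
  T _ := c.Usr
  W k := c.Rest k
  zeroS := ()
  zeroT := 0
  initS := ⟨fun s => (s.1, s.2, ()), fun s => (s.1, s.2.1), fun _ => rfl, fun _ => rfl⟩
  initT := ⟨fun p => (p.2.1, p.2.2, p.1), fun p => (p.2.2, p.1, p.2.1), fun _ => rfl, fun _ => rfl⟩
  -- The first query is the fixed register `zeroT`. Its cell takes the place of the shift that the
  -- server gives away in its first answer.
  D i := if i = 0 then 1 else (1 : Matrix (c.Comm × c.Usr) (c.Comm × c.Usr) ℂ).submatrix
    c.queryEquiv id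
  E i := if i = 0 then c.teleport else (1 : Matrix (c.Comm × c.Srv) (c.Comm × c.Srv) ℂ).submatrix
    c.answerEquiv id
  -- Only the Bell labels are measured; pad and shift remain coherent.
  out i s := if i = 0 then Fintype.equivFin (MsgIdx d × MsgIdx d) (s.1, s.2.1) else 0
  Dfin k := c.correction k
  unitary_D i _ := by
    split_ifs
    · exact IsUnitaryMap.one
    · exact IsUnitaryMap.one.submatrix c.queryEquiv (Equiv.refl _)
  unitary_E i _ := by
    split_ifs
    · exact (bell_unitary d).kronecker_one.submatrix _ _
    · exact IsUnitaryMap.one.submatrix c.answerEquiv (Equiv.refl _)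
  unitary_Dfin k := (IsUnitaryMap.blockDiagonal fun r =>
    (weyl_unitary (d k) (c.label k r)).conjTranspose).submatrix (Equiv.refl _) (c.targetEquiv k)

end BitLayout

namespace BitLayout

variable {F : ℕ} {d : Fin F → ℕ} (c : BitLayout d)

/-! ### Evolution of the state -/

/-- Normalization of the shared entanglement. -/
noncomputable def entNorm : ℂ := ((Real.sqrt (Fintype.card c.Ent))⁻¹ : ℝ)

/-- Initial amplitudes. -/
noncomputable def amp₀ (k : Fin F) : Matrix (c.Srv × c.Comm × c.Usr) (MsgIdx d) ℂ :=
  of fun p x => if p.1.1 = x ∧ p.1.2 = p.2.2.2 ∧ p.2.2.1 = k ∧ p.2.1 = 0 then c.entNorm else 0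

/-- Amplitudes after the first round, for the measurement outcome `m`. -/
noncomputable def amp₁ (k : Fin F) (m : MsgIdx d × MsgIdx d) :
    Matrix (c.Srv × c.Comm × c.Usr) (MsgIdx d) ℂ :=
  of fun p x => if (p.1.1, p.1.2.1) = m ∧ p.1.2.2.1 = p.2.2.2.2.1 + c.shifted m p.2.2.2.2.2 ∧
      p.1.2.2.2 = 0 ∧ p.2.1 = (p.2.2.2.2.2, 0) ∧ p.2.2.1 = k then
    c.entNorm * ((Real.sqrt (Fintype.card (MsgIdx d)))⁻¹ : ℝ) * weylProd d m p.2.2.2.1 x else 0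

/-- Amplitudes after the second query. -/
noncomputable def amp₂ (k : Fin F) (m : MsgIdx d × MsgIdx d) :
    Matrix (c.Srv × c.Comm × c.Usr) (MsgIdx d) ℂ :=
  of fun p x => if (p.1.1, p.1.2.1) = m ∧ p.1.2.2.1 = p.2.2.2.2.1 + c.shifted m p.2.2.2.2.2 ∧
      p.1.2.2.2 = 0 ∧ p.2.1 = (p.2.2.2.2.2 + c.start k, 0) ∧ p.2.2.1 = k then
    c.entNorm * ((Real.sqrt (Fintype.card (MsgIdx d)))⁻¹ : ℝ) * weylProd d m p.2.2.2.1 x else 0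

/-- Amplitudes after the second round. -/
noncomputable def amp₃ (k : Fin F) (m : MsgIdx d × MsgIdx d) :
    Matrix (c.Srv × c.Comm × c.Usr) (MsgIdx d) ℂ :=
  of fun p x => if (p.1.1, p.1.2.1) = m ∧ p.1.2.2.1 = p.2.2.2.2.1 + c.shifted m p.2.2.2.2.2 ∧
      p.1.2.2.2 = 0 ∧ p.2.1 = (p.2.2.2.2.2 + c.start k,
        c.window p.1.2.2.1 (p.2.2.2.2.2 + c.start k)) ∧ p.2.2.1 = k then
    c.entNorm * ((Real.sqrt (Fintype.card (MsgIdx d)))⁻¹ : ℝ) * weylProd d m p.2.2.2.1 x else 0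

theorem state_zero [∀ ℓ, NeZero (d ℓ)] (k : Fin F)
    (σ : Matrix (MsgIdx d) (MsgIdx d) ℂ) :
    c.protocol.state k σ 0 = krausMap (fun _ : Unit => c.amp₀ k) σ := by
  refine (c.protocol.initState_eq_krausMap k σ).trans (congrArg (krausMap · σ) ?_)
  funext _
  ext (p : c.Srv × c.Comm × c.Usr) x
  by_cases h : p.1.1 = x ∧ p.1.2 = p.2.2.2 ∧ p.2.2.1 = k ∧ p.2.1 = 0
  · refine Eq.trans ?_ (if_pos h).symm
    exact (if_pos h.1.symm).trans (if_pos ⟨rfl, h.2.2.1, h.2.2.2, h.2.1⟩)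
  · refine Eq.trans ?_ (if_neg h).symm
    by_cases hx : x = p.1.1
    · exact (if_pos hx).trans (if_neg fun h' => h ⟨hx.symm, h'.2.2.2, h'.2.1, h'.2.2.1⟩)
    · exact if_neg hx

theorem sum_one_submatrix_mul {Y : Type} [Fintype Y] [DecidableEq Y] (g : Y → Y) (y : Y)
    (f : Y → ℂ) : ∑ r, (1 : Matrix Y Y ℂ).submatrix g id y r * f r = f (g y) := by
  simp [Matrix.one_apply]

theorem userStep_state_zero [∀ ℓ, NeZero (d ℓ)] (k : Fin F)
    (σ : Matrix (MsgIdx d) (MsgIdx d) ℂ) :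
    c.protocol.userStep 0 (c.protocol.state k σ 0) =
      krausMap (fun _ : Unit => c.amp₀ k) σ := by
  rw [state_zero]
  refine (c.protocol.userStep_krausMap 0 _ σ).trans (congrArg (krausMap · σ) ?_)
  funext _
  ext p x
  exact sum_one_submatrix_mul id p.2 fun r => c.amp₀ k (p.1, r) x

theorem serverView_zero [∀ ℓ, NeZero (d ℓ)] (k : Fin F)
    (σ : Matrix (MsgIdx d) (MsgIdx d) ℂ) :
    c.protocol.serverView k σ 0 = krausMap (fun i : Unit × c.Usr =>
      (c.amp₀ k).submatrix (fun p : c.Srv × c.Comm => (p.1, p.2, i.2)) id) σ := by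
  refine (c.protocol.serverView_krausMap k σ 0 _ (c.state_zero k σ)).trans
    (congrArg (krausMap · σ) ?_)
  funext i
  ext p x
  exact sum_one_submatrix_mul id (p.2, i.2) fun r => c.amp₀ k (p.1, r) x

/-- The teleportation identity: projecting the message and the server's half onto a Bell state
leaves the corresponding Weyl operator, applied to the message, on the user's half. -/
theorem sum_teleport_mul (k : Fin F) (p : c.Srv × c.Comm × c.Usr) (x : MsgIdx d) :
    ∑ r : c.Comm × c.Srv, c.teleport (p.2.1, p.1) r * c.amp₀ k (r.2, r.1, p.2.2) x =
      c.amp₁ k (p.1.1, p.1.2.1) p x := by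
  obtain ⟨⟨m₁, m₂, w, b⟩, ⟨a, v⟩, j, e, z, s⟩ := p
  -- The initial amplitude is supported where the server's halves of the entanglement equal those of
  -- the user, so a single term survives.
  rw [Finset.sum_eq_single ((0, 0), (x, e, z, s))]
  · by_cases hj : j = k
    · have h0 : c.amp₀ k ((x, e, z, s), ((0 : c.Cell), 0), (j, e, z, s)) x = c.entNorm :=
        if_pos ⟨rfl, rfl, hj, rfl⟩
      rw [h0]
      simp only [teleport, submatrix_apply, padEquiv, bellEquiv, Equiv.coe_fn_mk,
        kroneckerMap_apply, Matrix.one_apply, amp₁, of_apply, bell, Prod.mk.injEq]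
      by_cases hb : b = 0 <;> by_cases hv : v = 0 <;> by_cases ha : a = s <;>
        simp [hb, hv, ha, hj, sub_eq_iff_eq_add]
      split_ifs <;> ring
    · have h0 : c.amp₀ k ((x, e, z, s), ((0 : c.Cell), 0), (j, e, z, s)) x = 0 :=
        if_neg fun h => hj h.2.2.1
      rw [h0, mul_zero]
      exact (if_neg fun h => hj h.2.2.2.2).symm
  · rintro ⟨q, x', e'⟩ _ h
    have h0 : c.amp₀ k ((x', e'), q, (j, e, z, s)) x = 0 := by
      refine if_neg fun h' => h ?_
      rw [show x' = x from h'.1, show e' = (e, z, s) from h'.2.1, show q = 0 from h'.2.2.2]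
      rfl
    exact mul_eq_zero_of_right _ h0
  · simp

theorem state_one [∀ ℓ, NeZero (d ℓ)] (k : Fin F)
    (σ : Matrix (MsgIdx d) (MsgIdx d) ℂ) :
    c.protocol.state k σ 1 =
      krausMap (fun i : Unit × (MsgIdx d × MsgIdx d) => c.amp₁ k i.2) σ := by
  refine (congrArg (c.protocol.serverStep 0) (c.userStep_state_zero k σ)).trans ?_
  refine (c.protocol.serverStep_krausMap 0 (fun s : c.Srv => (s.1, s.2.1)) ?_ _ σ).trans
    (congrArg (krausMap · σ) ?_)
  · intro s s'
    exact Fin.val_inj.trans (Equiv.apply_eq_iff_eq _)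
  funext i
  ext (p : c.Srv × c.Comm × c.Usr) x
  by_cases h : (p.1.1, p.1.2.1) = i.2
  · refine (if_pos h).trans ((c.sum_teleport_mul k p x).trans ?_)
    rw [h]
  · exact (if_neg h).trans (if_neg fun h' => h h'.1).symm

theorem amp₁_queryEquiv (k : Fin F) (m : MsgIdx d × MsgIdx d) (s : c.Srv) (t : c.Comm × c.Usr)
    (x : MsgIdx d) : c.amp₁ k m (s, c.queryEquiv t) x = c.amp₂ k m (s, t) x := by
  obtain ⟨⟨a, v⟩, j, e⟩ := t
  simp only [amp₁, amp₂, of_apply, queryEquiv, Equiv.coe_fn_mk, Prod.mk.injEq, sub_eq_iff_eq_add]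
  by_cases hj : j = k <;> simp [hj]

theorem userStep_state_one [∀ ℓ, NeZero (d ℓ)] (k : Fin F)
    (σ : Matrix (MsgIdx d) (MsgIdx d) ℂ) :
    c.protocol.userStep 1 (c.protocol.state k σ 1) =
      krausMap (fun i : Unit × (MsgIdx d × MsgIdx d) => c.amp₂ k i.2) σ := by
  rw [state_one]
  refine (c.protocol.userStep_krausMap 1 _ σ).trans (congrArg (krausMap · σ) ?_)
  funext i
  ext p x
  exact (sum_one_submatrix_mul c.queryEquiv p.2 fun r => c.amp₁ k i.2 (p.1, r) x).trans
    (c.amp₁_queryEquiv k i.2 p.1 p.2 x)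

theorem serverView_one [∀ ℓ, NeZero (d ℓ)] (k : Fin F)
    (σ : Matrix (MsgIdx d) (MsgIdx d) ℂ) :
    c.protocol.serverView k σ 1 = krausMap (fun i : (Unit × (MsgIdx d × MsgIdx d)) × c.Usr =>
      (c.amp₂ k i.1.2).submatrix (fun p : c.Srv × c.Comm => (p.1, p.2, i.2)) id) σ := by
  refine (c.protocol.serverView_krausMap k σ 1 _ (c.state_one k σ)).trans
    (congrArg (krausMap · σ) ?_)
  funext i
  ext p x
  exact (sum_one_submatrix_mul c.queryEquiv (p.2, i.2) fun r => c.amp₁ k i.1.2 (p.1, r) x).trans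
    (c.amp₁_queryEquiv k i.1.2 p.1 (p.2, i.2) x)

theorem amp₂_answerEquiv (k : Fin F) (m : MsgIdx d × MsgIdx d) (r : c.Comm × c.Srv) (t : c.Usr)
    (x : MsgIdx d) : c.amp₂ k m ((c.answerEquiv r).2, (c.answerEquiv r).1, t) x =
      c.amp₃ k m (r.2, r.1, t) x := by
  obtain ⟨⟨a, v⟩, m₁, m₂, w, b⟩ := r
  simp only [amp₂, amp₃, of_apply, answerEquiv, Equiv.coe_fn_mk, Prod.mk.injEq, sub_eq_zero]
  -- On the support the window is read at the cell of the query, which there equals `s + c.start k`.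
  by_cases ha : a = t.2.2.2 + c.start k <;> simp [ha]

theorem state_two [∀ ℓ, NeZero (d ℓ)] (k : Fin F)
    (σ : Matrix (MsgIdx d) (MsgIdx d) ℂ) :
    c.protocol.state k σ 2 =
      krausMap (fun i : (Unit × (MsgIdx d × MsgIdx d)) × Unit => c.amp₃ k i.1.2) σ := by
  refine (congrArg (c.protocol.serverStep 1) (c.userStep_state_one k σ)).trans ?_
  refine (c.protocol.serverStep_krausMap 1 (fun _ => ()) ?_ _ σ).trans
    (congrArg (krausMap · σ) ?_)
  · intro s s'
    exact iff_of_true rfl rfl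
  funext i
  ext (p : c.Srv × c.Comm × c.Usr) x
  refine Eq.trans (if_pos (e := 0) (Subsingleton.elim () i.2)) ?_
  exact (sum_one_submatrix_mul c.answerEquiv (p.2.1, p.1) fun r =>
    c.amp₂ k i.1.2 (r.2, r.1, p.2.2) x).trans (c.amp₂_answerEquiv k i.1.2 (p.2.1, p.1) p.2.2 x)

/-! ### User secrecy -/

/-- The registers of the user for target index `k'` that give the same view of the server as the
given ones for target index `k`. -/
def relabel (k k' : Fin F) (i : (Unit × (MsgIdx d × MsgIdx d)) × c.Usr) :
    (Unit × (MsgIdx d × MsgIdx d)) × c.Usr :=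
  (i.1, Equiv.swap k k' i.2.1, i.2.2.1,
    i.2.2.2.1 + c.shifted i.1.2 i.2.2.2.2 -
      c.shifted i.1.2 (i.2.2.2.2 + c.start k - c.start k'),
    i.2.2.2.2 + c.start k - c.start k')

theorem relabel_relabel (k k' : Fin F) (i : (Unit × (MsgIdx d × MsgIdx d)) × c.Usr) :
    c.relabel k' k (c.relabel k k' i) = i := by
  obtain ⟨m, j, e, z, s⟩ := i
  simp [relabel, Equiv.swap_comm k' k]

/-- The new shift keeps `s + c.start k`, and the new pad keeps `z + c.shifted m s`. These are the
only ways in which the server's registers depend on `s` and `z`. The teleported system is unchanged,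
and the swap moves the target register from `k` to `k'`. -/
theorem amp₂_relabel (k k' : Fin F) (i : (Unit × (MsgIdx d × MsgIdx d)) × c.Usr)
    (s : c.Srv) (q : c.Comm) (x : MsgIdx d) :
    c.amp₂ k' (c.relabel k k' i).1.2 (s, q, (c.relabel k k' i).2) x =
      c.amp₂ k i.1.2 (s, q, i.2) x := by
  have h : Equiv.swap k k' i.2.1 = k' ↔ i.2.1 = k := by
    rw [Equiv.swap_apply_eq_iff, Equiv.swap_apply_right]
  simp [amp₂, relabel, h]

theorem protocol_secret [∀ ℓ, NeZero (d ℓ)] : c.protocol.Secret := by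
  intro ρ _ k k' i hi
  -- The views agree for every joint state of the messages, product or not.
  generalize (of fun x x' => ∏ ℓ, ρ ℓ (x ℓ) (x' ℓ) : Matrix (MsgIdx d) (MsgIdx d) ℂ) = σ
  have hi' : i < 2 := hi
  interval_cases i
  · rw [serverView_zero, serverView_zero]
    -- Before the second query the target index sits only in the user's memory, so swapping its
    -- values is enough.
    rw [← krausMap_equiv ((Equiv.refl Unit).prodCongr
      ((Equiv.swap k k').prodCongr (Equiv.refl c.Ent))) (fun i : Unit × c.Usr =>
        (c.amp₀ k').submatrix (fun p : c.Srv × c.Comm => (p.1, p.2, i.2)) id)]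
    congr 1
    funext i
    ext p x
    have h : Equiv.swap k k' i.2.1 = k' ↔ i.2.1 = k := by
      rw [Equiv.swap_apply_eq_iff, Equiv.swap_apply_right]
    simp [amp₀, h]
  · rw [serverView_one, serverView_one]
    rw [← krausMap_equiv ⟨c.relabel k k', c.relabel k' k, c.relabel_relabel k k',
      c.relabel_relabel k' k⟩ (fun i : (Unit × (MsgIdx d × MsgIdx d)) × c.Usr =>
        (c.amp₂ k' i.1.2).submatrix (fun p : c.Srv × c.Comm => (p.1, p.2, i.2)) id)]
    congr 1
    funext i
    ext p x
    exact (c.amp₂_relabel k k' i p.1 p.2 x).symm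

end BitLayout

/-! ### The input-output map -/

namespace BitLayout

variable {F : ℕ} {d : Fin F → ℕ} (c : BitLayout d)

/-- The joint label of all messages, for a label of the message `k` and labels of the others. -/
def join (d : Fin F → ℕ) (k : Fin F) (a : Fin (d k)) (r : (ℓ : {ℓ // ℓ ≠ k}) → Fin (d ℓ)) :
    MsgIdx d :=
  (Equiv.piSplitAt k fun ℓ => Fin (d ℓ)).symm (a, r)

theorem join_self (k : Fin F) (a : Fin (d k)) (r : (ℓ : {ℓ // ℓ ≠ k}) → Fin (d ℓ)) :
    join d k a r k = a := by
  simp [join]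

theorem join_ne (k : Fin F) (a : Fin (d k)) (r : (ℓ : {ℓ // ℓ ≠ k}) → Fin (d ℓ))
    (ℓ : {ℓ // ℓ ≠ k}) : join d k a r ℓ = r ℓ := by
  simp [join, ℓ.2]

theorem sum_join {M : Type} [AddCommMonoid M] (k : Fin F) (f : MsgIdx d → M) :
    ∑ x, f x = ∑ a, ∑ r, f (join d k a r) := by
  rw [← (Equiv.piSplitAt k fun ℓ => Fin (d ℓ)).symm.sum_comp, Fintype.sum_prod_type]
  rfl

/-- Entries of the tensor product of the Weyl operators for all messages but the `k`-th. -/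
noncomputable def weylRest (d : Fin F → ℕ) (k : Fin F) (m : MsgIdx d × MsgIdx d)
    (e r : (ℓ : {ℓ // ℓ ≠ k}) → Fin (d ℓ)) : ℂ :=
  ∏ ℓ : {ℓ // ℓ ≠ k}, weyl (d ℓ) (m.1 ℓ, m.2 ℓ) (e ℓ) (r ℓ)

theorem weylProd_join (k : Fin F) (m : MsgIdx d × MsgIdx d) (a b : Fin (d k))
    (e r : (ℓ : {ℓ // ℓ ≠ k}) → Fin (d ℓ)) :
    weylProd d m (join d k a e) (join d k b r) =
      weyl (d k) (m.1 k, m.2 k) a b * weylRest d k m e r := by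
  rw [weylProd, Fintype.prod_eq_mul_prod_subtype_ne _ k, join_self, join_self, weylRest]
  simp only [join_ne]

theorem sum_star_weyl_mul_weyl (n : ℕ) (g : Fin n × Fin n) (a b : Fin n) :
    ∑ e, star (weyl n g e a) * weyl n g e b = if a = b then 1 else 0 := by
  have h := congrFun (congrFun (weyl_unitary n g).1 a) b
  rwa [Matrix.mul_apply, Matrix.one_apply] at h

/-- Unitarity of the Weyl operators on the other messages: summing over the encrypted contents `e`
turns encryption followed by discarding into a plain partial trace. -/
theorem sum_weylRest_mul_star (k : Fin F) (m : MsgIdx d × MsgIdx d)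
    (r r' : (ℓ : {ℓ // ℓ ≠ k}) → Fin (d ℓ)) :
    ∑ e, weylRest d k m e r * star (weylRest d k m e r') = if r = r' then 1 else 0 := by
  simp only [weylRest, star_prod, ← Finset.prod_mul_distrib]
  rw [← Fintype.piFinset_univ, ← Finset.prod_univ_sum (fun _ => Finset.univ)
    fun (ℓ : {ℓ // ℓ ≠ k}) e => weyl (d ℓ) (m.1 ℓ, m.2 ℓ) e (r ℓ) *
      star (weyl (d ℓ) (m.1 ℓ, m.2 ℓ) e (r' ℓ))]
  simp only [mul_comm _ (star _), sum_star_weyl_mul_weyl]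
  by_cases h : r = r'
  · simp [h]
  · rw [if_neg h]
    obtain ⟨ℓ, hℓ⟩ := Function.ne_iff.1 h
    exact Finset.prod_eq_zero (Finset.mem_univ ℓ) (if_neg hℓ.symm)

/-- The correction is controlled by the registers in `c.Rest k`, so it is block diagonal and each
block acts on the target alone. -/
theorem sum_correction_mul (k : Fin F) (o : Fin (d k)) (r : c.Rest k) (f : c.Comm × c.Usr → ℂ) :
    ∑ t, c.correction k (o, r) t * f t =
      ∑ a, star (weyl (d k) (c.label k r) a o) * f (r.2.1, r.2.2.1, join d k a r.1, r.2.2.2) := by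
  rw [← (c.targetEquiv k).symm.sum_comp, Fintype.sum_prod_type]
  refine Finset.sum_congr rfl fun a _ => ?_
  rw [Finset.sum_eq_single r]
  · simp only [correction, submatrix_apply, id, Equiv.apply_symm_apply, blockDiagonal_apply, if_true,
      conjTranspose_apply]
    rfl
  · intro r' _ hr
    simp only [correction, submatrix_apply, id, Equiv.apply_symm_apply, blockDiagonal_apply,
      if_neg hr.symm, zero_mul]
  · simp

/-- The labels of the nonzero Kraus operators of the protocol: labels of the generalized Bell
states, final contents of the systems of the user that hold the other messages, pad, shift. -/
abbrev KrausIdx (k : Fin F) : Type :=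
  (MsgIdx d × MsgIdx d) × ((ℓ : {ℓ : Fin F // ℓ ≠ k}) → Fin (d ℓ)) × c.Tape × c.Cell

/-- The registers that are traced out, for a nonzero Kraus operator. -/
def traced (k : Fin F) (i : c.KrausIdx k) :
    (((Unit × (MsgIdx d × MsgIdx d)) × Unit) × c.Srv) × c.Rest k :=
  (((((), i.1), ()), (i.1.1, i.1.2, i.2.2.1 + c.shifted i.1 i.2.2.2, 0)),
    (i.2.1, (i.2.2.2 + c.start k, c.window (i.2.2.1 + c.shifted i.1 i.2.2.2)
      (i.2.2.2 + c.start k)), k, i.2.2.1, i.2.2.2))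

theorem traced_injective (k : Fin F) : (c.traced k).Injective := by
  rintro ⟨m, e, z, s⟩ ⟨m', e', z', s'⟩ h
  simp only [traced, Prod.mk.injEq] at h
  simp [h]

/-- Normalization of the Kraus operators. -/
noncomputable def krausNorm : ℂ :=
  c.entNorm * ((Real.sqrt (Fintype.card (MsgIdx d)))⁻¹ : ℝ)

/-- The label decoded from the registers is the true one, so the Weyl operator on the target cancels
and the identity is left there. -/
theorem sum_correction_amp₃ (k : Fin F) (i : c.KrausIdx k) (o a : Fin (d k))
    (r : (ℓ : {ℓ // ℓ ≠ k}) → Fin (d ℓ)) :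
    ∑ t, c.correction k (o, (c.traced k i).2) t *
        c.amp₃ k (c.traced k i).1.1.1.2 ((c.traced k i).1.2, t) (join d k a r) =
      if o = a then c.krausNorm * weylRest d k i.1 i.2.1 r else 0 := by
  obtain ⟨m, e, z, s⟩ := i
  rw [sum_correction_mul]
  have h1 (b : Fin (d k)) : c.amp₃ k m ((m.1, m.2, z + c.shifted m s, (0 : c.Cell)),
      (s + c.start k, c.window (z + c.shifted m s) (s + c.start k)), k, join d k b e, z, s)
      (join d k a r) =
      weyl (d k) (m.1 k, m.2 k) b a * (c.krausNorm * weylRest d k m e r) := by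
    rw [amp₃, of_apply, if_pos ⟨rfl, rfl, rfl, rfl, rfl⟩, weylProd_join, krausNorm]
    ring
  simp only [traced, h1, label, c.decode_window k m z s, ← mul_assoc]
  rw [← Finset.sum_mul, ← Finset.sum_mul, sum_star_weyl_mul_weyl]
  split_ifs <;> simp

/-- The support conditions of `amp₃` determine all traced registers from the label, the other
messages, the pad and the shift. -/
theorem sum_correction_amp₃_eq_zero (k : Fin F)
    (j : (((Unit × (MsgIdx d × MsgIdx d)) × Unit) × c.Srv) × c.Rest k)
    (hj : j ∉ Set.range (c.traced k)) (o : Fin (d k)) (x : MsgIdx d) :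
    ∑ t, c.correction k (o, j.2) t * c.amp₃ k j.1.1.1.2 (j.1.2, t) x = 0 := by
  rw [sum_correction_mul]
  refine Finset.sum_eq_zero fun a _ => mul_eq_zero_of_right _ ?_
  rw [amp₃, of_apply, if_neg]
  rintro ⟨h1, h2, h3, h4, h5⟩
  obtain ⟨⟨⟨⟨_, m⟩, _⟩, m₁, m₂, w, b⟩, e, q, k', z, s⟩ := j
  dsimp only at h1 h2 h3 h4 h5
  subst h1 h2 h3 h4 h5
  exact hj ⟨((m₁, m₂), e, z, s), rfl⟩

/-- Labels, pads and shifts are uniformly distributed: the squared norm is the inverse of their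
number, because `c.Ent` contains one further copy of `MsgIdx d`. -/
theorem card_mul_krausNorm [∀ ℓ, NeZero (d ℓ)] :
    (Fintype.card (MsgIdx d × MsgIdx d) * (Fintype.card c.Tape * Fintype.card c.Cell) : ℂ) *
      (c.krausNorm * star c.krausNorm) = 1 := by
  have h : c.krausNorm * star c.krausNorm =
      (Fintype.card c.Ent : ℂ)⁻¹ * (Fintype.card (MsgIdx d) : ℂ)⁻¹ := by
    rw [← inv_sqrt_mul_self, ← inv_sqrt_mul_self, krausNorm, entNorm, star_mul', Complex.star_def,
      Complex.conj_ofReal, Complex.conj_ofReal]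
    ring
  have h1 : (Fintype.card (MsgIdx d) : ℂ) ≠ 0 := Nat.cast_ne_zero.2 Fintype.card_ne_zero
  have h2 : (Fintype.card c.Tape : ℂ) ≠ 0 := Nat.cast_ne_zero.2 Fintype.card_ne_zero
  have h3 : (Fintype.card c.Cell : ℂ) ≠ 0 := Nat.cast_ne_zero.2 Fintype.card_ne_zero
  rw [h, Fintype.card_prod, Fintype.card_prod, Fintype.card_prod]
  push_cast
  field_simp

theorem protocol_channel_eq_krausMap [∀ ℓ, NeZero (d ℓ)] (k : Fin F)
    (σ : Matrix (MsgIdx d) (MsgIdx d) ℂ) :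
    c.protocol.channel k σ = krausMap
      (fun j : (((Unit × (MsgIdx d × MsgIdx d)) × Unit) × c.Srv) × c.Rest k => of fun o x =>
        ∑ t, c.correction k (o, j.2) t * c.amp₃ k j.1.1.1.2 (j.1.2, t) x) σ := by
  have h := c.protocol.channel_krausMap k σ
    (fun i : (Unit × (MsgIdx d × MsgIdx d)) × Unit => c.amp₃ k i.1.2) (c.state_two k σ)
  refine h.trans ?_
  refine congrArg (krausMap
    (ι := (((Unit × (MsgIdx d × MsgIdx d)) × Unit) × c.Srv) × c.Rest k) · σ) ?_
  funext j
  ext o x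
  rfl

/-- The protocol realizes the partial trace over all messages but the target. -/
theorem protocol_channel [∀ ℓ, NeZero (d ℓ)] (k : Fin F) (σ : Matrix (MsgIdx d) (MsgIdx d) ℂ) :
    c.protocol.channel k σ = of fun o o' => ∑ r, σ (join d k o r) (join d k o' r) := by
  rw [protocol_channel_eq_krausMap, krausMap_of_injective (c.traced k) (c.traced_injective k)]
  · ext o o'
    rw [krausMap_apply]
    have h1 (i : c.KrausIdx k) (A : Matrix (Fin (d k)) (MsgIdx d) ℂ) (hA : A = of fun o x =>
        ∑ t, c.correction k (o, (c.traced k i).2) t *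
          c.amp₃ k (c.traced k i).1.1.1.2 ((c.traced k i).1.2, t) x) :
        (A * σ * Aᴴ) o o' = (c.krausNorm * star c.krausNorm) * ∑ r', ∑ r,
          σ (join d k o r) (join d k o' r') *
            (weylRest d k i.1 i.2.1 r * star (weylRest d k i.1 i.2.1 r')) := by
      have h2 (o a r) : A o (join d k a r) =
          if o = a then c.krausNorm * weylRest d k i.1 i.2.1 r else 0 := by
        rw [hA, of_apply, sum_correction_amp₃]
      simp only [Matrix.mul_apply, conjTranspose_apply, sum_join k, h2, apply_ite star, star_zero,
        ite_mul, zero_mul, mul_ite, mul_zero, Finset.sum_ite_irrel, Finset.sum_const_zero,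
        Finset.sum_ite_eq, Finset.mem_univ, if_true, Finset.mul_sum, Finset.sum_mul, star_mul']
      refine Finset.sum_congr rfl fun r' _ => Finset.sum_congr rfl fun r _ => ?_
      ring
    rw [Finset.sum_congr rfl fun i _ => h1 i _ rfl, ← Finset.mul_sum, Fintype.sum_prod_type]
    have h3 (m : MsgIdx d × MsgIdx d) :
        ∑ y : ((ℓ : {ℓ : Fin F // ℓ ≠ k}) → Fin (d ℓ)) × c.Tape × c.Cell, ∑ r', ∑ r,
          σ (join d k o r) (join d k o' r') *
            (weylRest d k m y.1 r * star (weylRest d k m y.1 r')) =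
        (Fintype.card c.Tape * Fintype.card c.Cell) *
          ∑ r, σ (join d k o r) (join d k o' r) := by
      rw [Fintype.sum_prod_type_right]
      simp only [Finset.sum_const, Finset.card_univ, Fintype.card_prod, nsmul_eq_mul]
      push_cast
      congr 1
      rw [Finset.sum_comm]
      refine Finset.sum_congr rfl fun r' _ => ?_
      rw [Finset.sum_comm]
      simp only [← Finset.mul_sum, sum_weylRest_mul_star]
      simp
    simp only [h3, Finset.sum_const, Finset.card_univ, nsmul_eq_mul]
    rw [of_apply]
    linear_combination (∑ r, σ (join d k o r) (join d k o' r)) * c.card_mul_krausNorm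
  · intro j hj
    ext o x
    exact c.sum_correction_amp₃_eq_zero k j hj o x

theorem protocol_correct [∀ ℓ, NeZero (d ℓ)] : c.protocol.Correct := by
  intro k ρ hρ R _ ψ _
  ext q q'
  rw [idTensor, of_apply, protocol_channel]
  simp only [of_apply, join_self]
  -- The partial trace over the other messages contributes the product of their traces, which is 1.
  have h (a a' : Fin (d k)) : ∑ r, ∏ ℓ ∈ Finset.univ.erase k,
      ρ ℓ (join d k a r ℓ) (join d k a' r ℓ) = 1 := by
    calc _ = ∑ r : (ℓ : {ℓ // ℓ ≠ k}) → Fin (d ℓ), ∏ ℓ : {ℓ // ℓ ≠ k}, ρ ℓ (r ℓ) (r ℓ) := by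
          refine Finset.sum_congr rfl fun r _ => ?_
          have hk (ℓ : Fin F) : ℓ ∈ Finset.univ.erase k ↔ ℓ ≠ k := by simp
          refine (Finset.prod_subtype _ hk _).trans (Finset.prod_congr rfl fun ℓ _ => ?_)
          rw [join_ne, join_ne]
      _ = ∏ ℓ : {ℓ // ℓ ≠ k}, ∑ e, ρ ℓ e e := by
          rw [Finset.prod_univ_sum, Fintype.piFinset_univ]
      _ = 1 := Finset.prod_eq_one fun ℓ _ => (hρ ℓ).2
  rw [← Finset.sum_mul, h, one_mul]

end BitLayout

/-! ### Existence of a short tape -/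

/-- The number of bits that encode a pair of elements of `Fin n`. -/
def pairBits (n : ℕ) : ℕ := Nat.clog 2 (n ^ 2)

theorem exists_pairCode (n : ℕ) :
    ∃ f : Fin n × Fin n → Fin (pairBits n) → ZMod 2, f.Injective := by
  have h : Fintype.card (Fin n × Fin n) ≤ Fintype.card (Fin (pairBits n) → ZMod 2) := by
    rw [Fintype.card_prod, Fintype.card_fun, ZMod.card, Fintype.card_fin, Fintype.card_fin, ← sq]
    exact Nat.le_pow_clog one_lt_two (n ^ 2)
  obtain ⟨f⟩ := Function.Embedding.nonempty_of_card_le h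
  exact ⟨f, f.injective⟩

theorem pairBits_pos {n : ℕ} (hn : 2 ≤ n) : 0 < pairBits n :=
  Nat.clog_pos one_lt_two (by nlinarith)

/-- Rounding up costs at most one bit, and 1 ≤ log₂ n when n ≥ 2; for n = 1 no bits are used. -/
theorem pairBits_le {n : ℕ} (hn : 1 ≤ n) : (pairBits n : ℝ) ≤ 3 * Real.logb 2 n := by
  rcases hn.eq_or_lt with rfl | hn
  · simp [pairBits]
  have h1 : 1 ≤ Real.logb 2 n := by
    rw [Real.le_logb_iff_rpow_le one_lt_two (by positivity)]
    simpa using (by exact_mod_cast hn : (2 : ℝ) ≤ n)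
  have h2 : 2 ^ (pairBits n - 1) < n ^ 2 := Nat.pow_pred_clog_lt_self one_lt_two (by nlinarith)
  have h3 : ((pairBits n - 1 : ℕ) : ℝ) ≤ 2 * Real.logb 2 n := by
    have h4 : ((n : ℝ) ^ 2) = (n : ℝ) ^ (2 : ℝ) := by norm_num
    rw [← Real.logb_rpow_eq_mul_logb_of_pos (by positivity), ← h4,
      Real.le_logb_iff_rpow_le one_lt_two (by positivity), Real.rpow_natCast]
    exact_mod_cast h2.le
  have h5 := pairBits_pos hn
  push_cast [Nat.cast_sub (Nat.one_le_iff_ne_zero.2 h5.ne')] at h3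
  linarith

section Layout

variable {F : ℕ} (d : Fin F → ℕ)

/-- A layout without gaps, on a tape of length `n + 1`. -/
theorem exists_bitLayout {n D : ℕ} (hn : ∑ ℓ, pairBits (d ℓ) = n + 1) (hd : ∀ ℓ, 1 ≤ d ℓ)
    (hD : ∀ ℓ, d ℓ ≤ D) :
    ∃ c : BitLayout d, Fintype.card c.Cell = n + 1 ∧ c.width = pairBits D := by
  choose code hcode using fun ℓ => exists_pairCode (d ℓ)
  have hB (ℓ : Fin F) : pairBits (d ℓ) ≤ pairBits D :=
    Nat.clog_mono_right 2 (Nat.pow_le_pow_left (hD ℓ) 2)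
  have hne (ℓ : Fin F) : Nonempty (Fin (d ℓ) × Fin (d ℓ)) := ⟨⟨0, hd ℓ⟩, ⟨0, hd ℓ⟩⟩
  -- Concatenation of the codes: bit `j` of message `ℓ` lies at the sum of the preceding code
  -- lengths plus `j`.
  let e : (Σ ℓ, Fin (pairBits (d ℓ))) ≃ ZMod (n + 1) := finSigmaFinEquiv.trans (finCongr hn)
  let start (ℓ : Fin F) : ZMod (n + 1) :=
    ((∑ i : Fin ℓ, pairBits (d (Fin.castLE ℓ.2.le i)) : ℕ) : ZMod (n + 1))
  have he (ℓ : Fin F) (j : Fin (pairBits (d ℓ))) :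
      start ℓ + ((j : ℕ) : ZMod (n + 1)) = e ⟨ℓ, j⟩ := by
    have h := finSigmaFinEquiv_apply (n := fun ℓ => pairBits (d ℓ)) ⟨ℓ, j⟩
    refine (Nat.cast_add _ _).symm.trans ?_
    exact (congrArg Nat.cast h.symm).trans (ZMod.natCast_zmod_val (e ⟨ℓ, j⟩))
  refine ⟨{
    Cell := ZMod (n + 1)
    width := pairBits D
    off := fun j => ((j : ℕ) : ZMod (n + 1))
    start := start
    tape := fun m p => code (e.symm p).1 (m.1 (e.symm p).1, m.2 (e.symm p).1) (e.symm p).2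
    -- All windows have the width of the longest possible code, so that their size does not reveal
    -- `k`. A window may run into later codes or wrap around; only its first `pairBits (d k)` bits
    -- are decoded.
    decode := fun k v => Function.invFun (code k) fun j => v (Fin.castLE (hB k) j)
    decode_tape := fun k m => ?_ }, ?_, rfl⟩
  · have h : (fun j : Fin (pairBits (d k)) => code k (m.1 k, m.2 k) j) =
        fun j : Fin (pairBits (d k)) =>
          code (e.symm (start k + ((Fin.castLE (hB k) j : ℕ) : ZMod (n + 1)))).1
            (m.1 (e.symm (start k + ((Fin.castLE (hB k) j : ℕ) : ZMod (n + 1)))).1,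
              m.2 (e.symm (start k + ((Fin.castLE (hB k) j : ℕ) : ZMod (n + 1)))).1)
            (e.symm (start k + ((Fin.castLE (hB k) j : ℕ) : ZMod (n + 1)))).2 := by
      funext j
      have h1 : e.symm (start k + ((Fin.castLE (hB k) j : ℕ) : ZMod (n + 1))) = ⟨k, j⟩ := by
        rw [Fin.val_castLE, he, Equiv.symm_apply_apply]
      rw [h1]
    rw [← h]
    exact Function.leftInverse_invFun (hcode k) _
  · exact ZMod.card (n + 1)

end Layout

/-! ### Costs of the protocol -/

namespace BitLayout

variable {F : ℕ} {d : Fin F → ℕ} (c : BitLayout d) [∀ ℓ, NeZero (d ℓ)]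

theorem protocol_ebits :
    c.protocol.ebits = totalSize d + Fintype.card c.Cell + Real.logb 2 (Fintype.card c.Cell) := by
  have h0 : c.protocol.ebits = Real.logb 2 (Fintype.card (MsgIdx d × c.Tape × c.Cell)) := rfl
  have h1 : (Fintype.card c.Cell : ℝ) ≠ 0 := Nat.cast_ne_zero.2 Fintype.card_ne_zero
  have h2 (ℓ : Fin F) : (d ℓ : ℝ) ≠ 0 := Nat.cast_ne_zero.2 (NeZero.ne _)
  have h3 : Real.logb 2 ((2 : ℝ) ^ Fintype.card c.Cell) = Fintype.card c.Cell := by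
    rw [← Real.rpow_natCast, Real.logb_rpow two_pos (by norm_num)]
  rw [h0, Fintype.card_prod, Fintype.card_prod, Fintype.card_fun, Fintype.card_pi, ZMod.card]
  push_cast
  rw [Real.logb_mul (Finset.prod_ne_zero_iff.2 fun ℓ _ => by simpa using h2 ℓ) (by positivity),
    Real.logb_mul (by positivity) h1, h3, Real.logb_prod _ _ fun ℓ _ => by simpa using h2 ℓ]
  simp [totalSize, add_assoc]

theorem protocol_commComplexity :
    c.protocol.commComplexity = 4 * (Real.logb 2 (Fintype.card c.Cell) + c.width) := by
  have h0 : c.protocol.commComplexity = ∑ i ∈ Finset.range 2,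
    (Real.logb 2 (Fintype.card c.Comm) + Real.logb 2 (Fintype.card c.Comm)) := rfl
  have h1 : (Fintype.card c.Cell : ℝ) ≠ 0 := Nat.cast_ne_zero.2 Fintype.card_ne_zero
  have h3 : Real.logb 2 ((2 : ℝ) ^ c.width) = c.width := by
    rw [← Real.rpow_natCast, Real.logb_rpow two_pos (by norm_num)]
  rw [h0, Fintype.card_prod, Fintype.card_fun, ZMod.card, Fintype.card_fin]
  push_cast
  rw [Real.logb_mul h1 (by positivity), h3]
  simp
  ring

end BitLayout

/-! ### Numerical estimates and the final bounds -/

theorem totalSize_eq_logb {F : ℕ} (d : Fin F → ℕ) (hd : ∀ ℓ, 1 ≤ d ℓ) :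
    totalSize d = Real.logb 2 ((∏ ℓ, d ℓ : ℕ) : ℝ) := by
  push_cast
  rw [Real.logb_prod _ _ fun ℓ _ => Nat.cast_ne_zero.2 (Nat.one_le_iff_ne_zero.1 (hd ℓ)),
    totalSize]

/-- The product of the dimensions is an integer, so M > 1 forces it to be at least 3, and 2³ ≤ 3².
This keeps log₂ M away from 0, so that additive constants can be absorbed. -/
theorem three_halves_le_totalSize {F : ℕ} (d : Fin F → ℕ) (hd : ∀ ℓ, 1 ≤ d ℓ)
    (h : 1 < totalSize d) : 3 / 2 ≤ totalSize d := by
  have hp : 0 < ∏ ℓ, d ℓ := Finset.prod_pos fun ℓ _ => hd ℓ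
  rw [totalSize_eq_logb d hd] at h ⊢
  generalize ∏ ℓ, d ℓ = p at h hp ⊢
  have hp' : (0 : ℝ) < p := Nat.cast_pos.2 hp
  rw [Real.lt_logb_iff_rpow_lt one_lt_two hp', Real.rpow_one] at h
  have h3 : (3 : ℝ) ≤ p := by
    have : 2 < p := by exact_mod_cast h
    exact_mod_cast this
  have h4 : Real.logb 2 ((p : ℝ) ^ 2) = 2 * Real.logb 2 p := by
    rw [Real.logb_pow]; norm_num
  have h5 : (3 : ℝ) ≤ Real.logb 2 ((p : ℝ) ^ 2) := by
    rw [Real.le_logb_iff_rpow_le one_lt_two (by positivity)]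
    norm_num
    nlinarith
  linarith

theorem one_half_le_logb {x : ℝ} (hx : 3 / 2 ≤ x) : 1 / 2 ≤ Real.logb 2 x := by
  have h4 : Real.logb 2 (x ^ 2) = 2 * Real.logb 2 x := by
    rw [Real.logb_pow]; norm_num
  have h5 : (1 : ℝ) ≤ Real.logb 2 (x ^ 2) := by
    rw [Real.le_logb_iff_rpow_le one_lt_two (by positivity), Real.rpow_one]
    nlinarith
  linarith

theorem logb_two_natCast_le {n : ℕ} (hn : 0 < n) : Real.logb 2 n ≤ n := by
  rw [Real.logb_le_iff_le_rpow one_lt_two (Nat.cast_pos.2 hn), Real.rpow_natCast]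
  exact_mod_cast Nat.lt_two_pow_self.le

theorem mainTheorem4 :
    ∃ c : ℝ, ∀ D : ℕ, ∃ C : ℝ, ∀ (F : ℕ) (d : Fin F → ℕ),
      (∀ ℓ, 1 ≤ d ℓ ∧ d ℓ ≤ D) → 1 < totalSize d →
        ∃ P : BlindQPIR d, P.Correct ∧ P.Secret ∧
          P.commComplexity ≤ C * Real.logb 2 (totalSize d) ∧ P.ebits ≤ c * totalSize d := by
  -- With N ≤ 3M, the ebits are M + N + log₂ N ≤ M + 3M + 3M. The communication is 4(log₂ N + B) ≤ 4
  -- log₂ M + 4(2 + B) with B = `pairBits D`, and 1 ≤ 2 log₂ M absorbs the constant.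
  refine ⟨7, fun D => ⟨4 + 8 * (2 + pairBits D), fun F d hd hM => ?_⟩⟩
  have hd1 : ∀ ℓ, 1 ≤ d ℓ := fun ℓ => (hd ℓ).1
  have hN : ((∑ ℓ, pairBits (d ℓ) : ℕ) : ℝ) ≤ 3 * totalSize d := by
    push_cast
    rw [totalSize, Finset.mul_sum]
    exact Finset.sum_le_sum fun ℓ _ => pairBits_le (hd1 ℓ)
  have hN0 : ∑ ℓ, pairBits (d ℓ) ≠ 0 := by
    intro h
    have h1 (ℓ : Fin F) : d ℓ = 1 := by
      by_contra hne
      have h2 : 0 < pairBits (d ℓ) := pairBits_pos (by have := hd1 ℓ; omega)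
      have h3 := Finset.sum_eq_zero_iff.1 h ℓ (Finset.mem_univ ℓ)
      omega
    have h4 : totalSize d = 0 := by simp [totalSize, h1]
    linarith
  -- A nonempty tape is needed: `ZMod 0` would be infinite.
  obtain ⟨n, hn⟩ := Nat.exists_eq_succ_of_ne_zero hN0
  obtain ⟨c, hc, hw⟩ := exists_bitLayout d hn hd1 fun ℓ => (hd ℓ).2
  have (ℓ : Fin F) : NeZero (d ℓ) := ⟨Nat.one_le_iff_ne_zero.1 (hd1 ℓ)⟩
  have hM' := three_halves_le_totalSize d hd1 hM
  have hlog := one_half_le_logb hM'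
  rw [hn] at hN
  refine ⟨c.protocol, c.protocol_correct, c.protocol_secret, ?_, ?_⟩
  · rw [c.protocol_commComplexity, hc, hw]
    have h1 : Real.logb 2 ((n + 1 : ℕ) : ℝ) ≤ 2 + Real.logb 2 (totalSize d) := by
      have h2 : Real.logb 2 (4 * totalSize d) = 2 + Real.logb 2 (totalSize d) := by
        rw [Real.logb_mul (by norm_num) (by positivity), show (4 : ℝ) = 2 ^ (2 : ℝ) by norm_num,
          Real.logb_rpow two_pos (by norm_num)]
      rw [← h2]
      exact Real.logb_le_logb_of_le one_lt_two (Nat.cast_pos.2 n.succ_pos) (by linarith)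
    have h3 : (0 : ℝ) ≤ pairBits D := Nat.cast_nonneg _
    nlinarith
  · rw [c.protocol_ebits, hc]
    have h1 := logb_two_natCast_le n.succ_pos
    simp only [Nat.succ_eq_add_one] at h1 hN
    linarith
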